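/- **Setting.** Let $G$ and $\Theta$ be finite groups, let $\Theta$ act on $G$ by automorphisms, and let $G\rtimes\Theta$ be the semidirect product, with $(g_1,\theta_1)(g_2,\theta_2)=(g_1\theta_1(g_2),\theta_1\theta_2)$. Let $\mathrm{Col}=\{0_+,0_-,1,2,\dots\}$, with $0_\pm+1=1$; in arithmetic expressions $0_\pm$ means $0$. A disc of colour $k\ge1$ has $2k$ marked points, numbered $0,\dots,2k-1$ clockwise from the white $*$-interval, and is drawn as a box with the points $0,\dots,k-1$ on top and the others at the bottom; its black intervals are those between the points $2j$ and $2j+1$, $0\le j<k$. The boundary of a disc of colour $0_+$ is white, that of a disc of colour $0_-$ is black. **Group planar algebra.** For a finite group $H$, $P(H)$ denotes the planar algebra of the group subfactor $R^H\subset R$, in its spin model: $P(H)_k$ is the space of complex functions $f(a_0,\dots,a_{k-1})$ of spins $a_j\in H$ on the black intervals (one spin if $k=0_-$, none if $k=0_+$) with $f(ha_0,\dots,ha_{k-1})=f(a_0,\dots,a_{k-1})$ for all $h\in H$. A shaded planar tangle $T=T^{k_0}_{k_1,\dots,k_b}$ acts by $$Z_T(f_1\otimes\cdots\otimes f_b)(a)=\sqrt{|H|}^{\,w(T)}\sum_{\sigma}\prod_{i=1}^b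 f_i(\sigma|_{D_i}),$$ where $\sigma$ runs over the assignments of spins to the black regions that induce $a$ on the external disc, and $w(T)$ is the total number of counterclockwise turns of the strings, followed with black on their right, when all discs are drawn as boxes with vertical strings at their marked points (so that a closed string has the value $\sqrt{|H|}$). The 2-box labelled $g\in H$ is the function that is $1$ if $a_0^{-1}a_1=g$ and $0$ otherwise. For $\bar g=(g_1,\dots,g_{k-1})\in H^{k-1}$ let $S(\bar g)\in P(H)_k$ be the string if $k=1$, the 2-box labelled $g_1$ if $k=2$, and, if $k\ge3$, the value of the tangle with $k-1$ internal 2-boxes labelled $g_1,\dots,g_{k-1}$ in which the second black interval of the $j$-th box faces the $j$-th black interval of the external disc, and the first black intervals of all boxes lie, in this order, along the black region at the last black interval of the external disc. Thus, for $k\ge 3$, $S(\bar g)(a)=\sqrt{|H|}^{\lceil k/2\rceil-1}$ if $a_{k-1}^{-1}a_{j-1}=g_j$ for $1\le j\le k-1$, and $S(\bar g)(a)=0$ otherwise. **The two sides.** $P^\Theta_k$ is the space of the $\Theta$-invariant elements of $P(G)_k$; tangles act on it by the restriction of $Z_T$. Put $\Theta S(\bar g)=\sum_{\theta\in\Theta}S(\theta(\bar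 g))\in P^\Theta_k$ for $\bar g\in G^{k-1}$. In $P(G\rtimes\Theta)$ let $q=|\Theta|^{-1}\sum_{\theta}(e,\theta)\in P(G\rtimes\Theta)_2$ be the biprojection of $R^{G\rtimes\Theta}\subset R^\Theta\subset R$. For $x\in P(G\rtimes\Theta)_k$ let $F_k(x)$ be $x$ surrounded by $k$ 2-boxes labelled $q$, one at each black interval ($F_{0_\pm}=\mathrm{id}$), and let $P'_k=F_k(P(G\rtimes\Theta)_k)$. For a tangle $T=T^{k_0}_{k_1,\dots,k_b}$ put $$Z'_T=\alpha(T)\,F_{k_0}\circ Z_T\ \text{ on inputs from }P',\qquad \alpha(T)=|\Theta|^{c(T)/2},\qquad c(T)=\lceil k_0/2\rceil+\sum_{i=1}^b\lfloor k_i/2\rfloor-l(T),$$ where $l(T)$ is the number of closed loops after joining the two end points of every black interval of every disc of $T$. For $k\ge 1$ and $\bar g\in G^{k-1}$ put $U(\bar g)=\sum_{\theta\in\Theta,\ \bar\gamma\in\Theta^{k-1}}S((\theta(g_1),\gamma_1),\dots,(\theta(g_{k-1}),\gamma_{k-1}))$. **Theorem.** There is exactly one family of linear maps $\Phi_k:P^\Theta_k\to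 P'_k$ ($k\in\mathrm{Col}$) such that $$\Phi_k(\Theta S(\bar g))=|\Theta|^{-\lfloor k/2\rfloor}\bigl(\sqrt{|\Theta|}\bigr)^{1-\lceil k/2\rceil}\,U(\bar g)\qquad(k\ge1,\ \bar g\in G^{k-1})$$ and $\Phi_{0_\pm}(1)=1$ (both spaces being the scalars). The set of the tangles $T=T^{k_0}_{k_1,\dots,k_b}$ with $$\Phi_{k_0}(Z_T(x_1\otimes\cdots\otimes x_b))=Z'_T(\Phi_{k_1}(x_1)\otimes\cdots\otimes\Phi_{k_b}(x_b))\qquad\text{for all }x_i\in P^\Theta_{k_i}$$ contains $$\{1^{0_+},1^{0_-}\}\cup\{\mathcal E^k:k\ge2\}\cup\{(E')^k_k:k\ge1\}\cup\{E^k_{k+1},M_k,I^{k+1}_k:k\in\mathrm{Col}\}.$$ Here $1^{0_\pm}$ are the unit tangles, without discs and strings inside; the Jones projection tangle $\mathcal E^k$ has no internal disc, $k-2$ vertical strings, a string joining the last two top points and a string joining the last two bottom points; the left conditional expectation tangle $(E')^k_k$ closes the first string of its box to the left and adds a vertical string at the left; the right conditional expectation tangle $E^k_{k+1}$ closes the last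 string of its box (to the right, and to the left for $k=0_-$); the multiplication tangle $M_k$ stacks the first box on top of the second; the inclusion tangle $I^{k+1}_k$ adds a vertical string to the right of its box (to the left for $k=0_-$). -/

import Mathlib

namespace GroupPlanar

noncomputable section

/-- The set of colours `Col = {0₊, 0₋, 1, 2, 3, …}`; `succ n` is the colour `n + 1`. -/
inductive Col : Type
  | zeroPlus : Col
  | zeroMinus : Col
  | succ (n : ℕ) : Col

namespace Col

/-- The integer underlying a colour. A disc of colour `k` has `2 * k.size` marked points. -/
def size : Col → ℕ
  | zeroPlus => 0
  | zeroMinus => 0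
  | succ n => n + 1

/-- The number of black sides of a disc of colour `k`: there are `k` black boundary intervals if
`k ≥ 1`, none if `k = 0₊`, and for `k = 0₋` the whole boundary circle is one black side. -/
def sides : Col → ℕ
  | zeroPlus => 0
  | zeroMinus => 1
  | succ n => n + 1

/-- The colour `k + 1`, with `0₊ + 1 = 0₋ + 1 = 1`. -/
def up (k : Col) : Col := succ k.size

/-- `1` for the colour `0₋`, and `0` for the other colours. -/
def isMinus : Col → ℕ
  | zeroMinus => 1
  | _ => 0

theorem size_succ (n : ℕ) : (succ n).size = n + 1 := rfl

theorem size_up (k : Col) : k.up.size = k.size + 1 := rfl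

theorem size_le_sides (k : Col) : k.size ≤ k.sides := by
  cases k <;> simp [size, sides]

/-- The marked points of a disc are numbered `0, …, 2k - 1` clockwise from the white `*`-interval
(on a box: the top points from left to right, then the bottom points from right to left). The black
intervals are those between the points `2j` and `2j + 1`; this is the one at which `p` lies. -/
def sideOf (k : Col) (p : Fin (2 * k.size)) : Fin k.sides :=
  ⟨p.val / 2, by have := k.size_le_sides; have := p.isLt; omega⟩

end Col

/-- The combinatorial data of a shaded tangle on which its action and `l(T)` depend. (Planarity is not
among them; all the tangles below are planar.) The marked points of the external disc are
`Sum.inl p`, those of the internal disc `i` are `Sum.inr ⟨i, p⟩`. -/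
structure Tangle : Type 1 where
  /-- The internal discs. -/
  Disc : Type
  [fintypeDisc : Fintype Disc]
  [decEqDisc : DecidableEq Disc]
  /-- The colour `k₀` of the external disc. -/
  ext : Col
  /-- The colours `kᵢ` of the internal discs. -/
  int : Disc → Col
  /-- The number of closed strings. -/
  circles : ℕ
  /-- The marked point at the other end of the string that starts at a marked point. -/
  string : (Fin (2 * ext.size) ⊕ (Σ i, Fin (2 * (int i).size))) →
    (Fin (2 * ext.size) ⊕ (Σ i, Fin (2 * (int i).size)))
  string_string : ∀ p, string (string p) = p
  /-- The strings respect the checkerboard shading: two points of internal discs, or two points of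
  the external disc, that are joined have different parity, and a point of the external disc and
  one of an internal disc that are joined have the same parity. -/
  shaded : ∀ p, (Sum.elim (fun a => a.val + 1) (fun a => a.2.val) (string p)) % 2 ≠
    (Sum.elim (fun a => a.val + 1) (fun a => a.2.val) p) % 2
  /-- Black sides (of the external disc, of the internal discs, of the closed strings) that lie on
  different components of the boundary of one black region. Nothing has to be recorded here
  if all black regions are simply connected. -/
  link : (Fin ext.sides ⊕ (Σ i, Fin (int i).sides) ⊕ Fin circles) →
    (Fin ext.sides ⊕ (Σ i, Fin (int i).sides) ⊕ Fin circles) → Prop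

attribute [instance] Tangle.fintypeDisc Tangle.decEqDisc

namespace Tangle

/-- The marked points on the discs of a tangle. -/
abbrev Point (T : Tangle) : Type :=
  Fin (2 * T.ext.size) ⊕ (Σ i, Fin (2 * (T.int i).size))

/-- The pieces of the boundary of the black part: the black sides of the external disc and of the
internal discs, and the closed strings. -/
abbrev Side (T : Tangle) : Type :=
  Fin T.ext.sides ⊕ (Σ i, Fin (T.int i).sides) ⊕ Fin T.circles

/-- The black interval at whose end a marked point lies. -/
def side (T : Tangle) : T.Point → T.Side
  | Sum.inl p => Sum.inl (T.ext.sideOf p)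
  | Sum.inr ⟨i, p⟩ => Sum.inr (Sum.inl ⟨i, (T.int i).sideOf p⟩)

/-- `l(T)`: the number of closed loops after capping the black intervals of the external disc and
cupping the black intervals of the internal discs, that is, after joining the two end points of
every black interval. -/
def loops (T : Tangle) : ℕ :=
  Nat.card (Quot fun p p' : T.Point => p' = T.string p ∨ T.side p' = T.side p) + T.circles

/-- Two black sides that lie in one black region because a string runs along the region from one to
the other, or because of a link. The black regions are the classes of the equivalence relation
generated by this. -/
def sameRegion (T : Tangle) (a b : T.Side) : Prop :=
  (∃ p : T.Point, a = T.side p ∧ b = T.side (T.string p)) ∨ T.link a b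

/-- The number of black regions. -/
def regions (T : Tangle) : ℕ := Nat.card (Quot T.sameRegion)

/-- The Euler characteristic of the black part. A region whose boundary has `c` components has
Euler characteristic `2 - c`. The components of the boundaries of the black regions are the `l(T)`
loops and the boundary circles of the discs of colour `0₋`. -/
def eulerBlack (T : Tangle) : ℤ :=
  2 * (T.regions : ℤ) - ((T.loops : ℤ) + T.ext.isMinus + ∑ i, ((T.int i).isMinus : ℤ))

/-- `⌈k₀/2⌉ + ⌊k₁/2⌋ + ⋯ + ⌊k_b/2⌋`. -/
def halfColours (T : Tangle) : ℤ :=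
  (((T.ext.size + 1) / 2 : ℕ) : ℤ) + ∑ i, (((T.int i).size / 2 : ℕ) : ℤ)

/-- `c(T) = ⌈k₀/2⌉ + ⌊k₁/2⌋ + ⋯ + ⌊k_b/2⌋ - l(T)`. -/
def c (T : Tangle) : ℤ := T.halfColours - T.loops

/-- The sum, over the strings, of the number of full counterclockwise turns of the string when it
is followed with the black region on its right and all discs are drawn as boxes with vertical strings at their
marked points. (By Gauss-Bonnet for the black regions.) -/
def turning (T : Tangle) : ℤ :=
  T.halfColours + T.ext.isMinus - (∑ i, ((T.int i).isMinus : ℤ)) - T.eulerBlack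

end Tangle

/-- The space of functions of a spin, in the group `H`, on each black side of a disc of colour
`k`. -/
abbrev Box (H : Type*) (k : Col) : Type _ := (Fin k.sides → H) → ℂ

section Action

variable {H : Type*} [Fintype H]

open Classical in
/-- The spins on all black sides that are constant on black regions and extend the given
spins of the external disc. -/
def states (T : Tangle) (a : Fin T.ext.sides → H) : Finset (T.Side → H) :=
  Finset.univ.filter fun s =>
    (∀ x y, T.sameRegion x y → s x = s y) ∧ ∀ j, s (Sum.inl j) = a j

/-- The multilinear operator `Z_T`: the state sum over the spins of the black regions, normalised
so that the value of a closed string is `√|H|`, whichever its shading. -/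
def Z (T : Tangle) : MultilinearMap ℂ (fun i => Box H (T.int i)) (Box H T.ext) :=
  MultilinearMap.pi fun a =>
    (((Real.sqrt (Fintype.card H) : ℝ) : ℂ) ^ T.turning) •
      ∑ s ∈ states T a,
        (MultilinearMap.mkPiAlgebra ℂ T.Disc ℂ).compLinearMap fun i =>
          LinearMap.proj fun j => s (Sum.inr (Sum.inl ⟨i, j⟩))

theorem Z_apply (T : Tangle) (f : ∀ i, Box H (T.int i)) (a : Fin T.ext.sides → H) :
    Z T f a = (((Real.sqrt (Fintype.card H) : ℝ) : ℂ) ^ T.turning) *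
      ∑ s ∈ states T a, ∏ i, f i (fun j => s (Sum.inr (Sum.inl ⟨i, j⟩))) := by
  simp [Z, MultilinearMap.pi_apply]

/-- `Z_T` commutes with permutations of the spins. -/
theorem Z_comp (T : Tangle) (e : Equiv.Perm H) (f : ∀ i, Box H (T.int i))
    (a : Fin T.ext.sides → H) :
    Z T f (fun j => e (a j)) = Z T (fun i b => f i (fun j => e (b j))) a := by
  rw [Z_apply, Z_apply]
  congr 1
  symm
  refine Finset.sum_bij (fun s _ => fun x => e (s x)) ?_ ?_ ?_ ?_
  · intro s hs
    simp only [states, Finset.mem_filter, Finset.mem_univ, true_and] at hs ⊢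
    exact ⟨fun x y h => by rw [hs.1 x y h], fun j => by rw [hs.2 j]⟩
  · intro s _ s' _ h
    funext x
    exact e.injective (congrFun h x)
  · intro s hs
    simp only [states, Finset.mem_filter, Finset.mem_univ, true_and] at hs
    refine ⟨fun x => e.symm (s x), ?_, ?_⟩
    · simp only [states, Finset.mem_filter, Finset.mem_univ, true_and]
      exact ⟨fun x y h => by rw [hs.1 x y h], fun j => by rw [hs.2 j]; simp⟩
    · funext x; simp
  · intro s _; rfl

theorem Z_comp' (T : Tangle) (e : Equiv.Perm H) (f f' : ∀ i, Box H (T.int i))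
    (h : ∀ i b, f i (fun j => e (b j)) = f' i b) (a : Fin T.ext.sides → H) :
    Z T f (fun j => e (a j)) = Z T f' a := by
  rw [Z_comp]
  exact congrFun (congrArg (Z T) (funext fun i => funext fun b => h i b)) a

end Action

section Tangles

open Col

/-- The unit tangle `1^{0₊}`: no internal discs, no strings. -/
def unitPlus : Tangle where
  Disc := Empty
  ext := zeroPlus
  int := fun i => i.elim
  circles := 0
  string := id
  string_string := fun _ => rfl
  shaded := by rintro (p | ⟨i, _⟩); exacts [p.elim0, i.elim]
  link := fun _ _ => False

/-- The unit tangle `1^{0₋}`: no internal discs, no strings. -/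
def unitMinus : Tangle where
  Disc := Empty
  ext := zeroMinus
  int := fun i => i.elim
  circles := 0
  string := id
  string_string := fun _ => rfl
  shaded := by rintro (p | ⟨i, _⟩); exacts [p.elim0, i.elim]
  link := fun _ _ => False

/-- The Jones projection tangle of colour `k = n + 2`: no internal discs, `k - 2` vertical
strings, a string that joins the last two top points, and one that joins the last two bottom
points. -/
def jones (n : ℕ) : Tangle where
  Disc := Empty
  ext := succ (n + 1)
  int := fun i => i.elim
  circles := 0
  string := fun
    | Sum.inl p =>
      if p.val = n then Sum.inl ⟨n + 1, by simp only [size_succ]; omega⟩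
      else if p.val = n + 1 then Sum.inl ⟨n, by simp only [size_succ]; omega⟩
      else if p.val = n + 2 then Sum.inl ⟨n + 3, by simp only [size_succ]; omega⟩
      else if p.val = n + 3 then Sum.inl ⟨n + 2, by simp only [size_succ]; omega⟩
      else Sum.inl p.rev
    | Sum.inr ⟨i, _⟩ => i.elim
  string_string := by
    rintro (p | ⟨i, _⟩)
    · have hp := p.isLt
      simp only [size_succ] at hp
      grind [Fin.ext_iff, size_succ]
    · exact i.elim
  shaded := by
    rintro (p | ⟨i, _⟩)
    · have hp := p.isLt
      simp only [size_succ] at hp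
      grind [size_succ]
    · exact i.elim
  link := fun _ _ => False

/-- The left conditional expectation tangle `(E')^k_k` for `k = n + 1`: the first string of the
internal box is closed to its left, a vertical string is added at the left, and all other points of
the internal box are joined to those of the external box. For `k = 1` the black region is an
annulus. -/
def leftExp (n : ℕ) : Tangle where
  Disc := Unit
  ext := succ n
  int := fun _ => succ n
  circles := 0
  string := fun
    | Sum.inl p =>
      if p.val = 0 ∨ p.val = 2 * n + 1 then Sum.inl p.rev else Sum.inr ⟨(), p⟩
    | Sum.inr ⟨_, p⟩ =>
      if p.val = 0 ∨ p.val = 2 * n + 1 then Sum.inr ⟨(), p.rev⟩ else Sum.inl p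
  string_string := by
    rintro (p | ⟨⟨⟩, p⟩) <;> have hp := p.isLt <;> grind [Fin.ext_iff, size_succ]
  shaded := by
    rintro (p | ⟨⟨⟩, p⟩) <;> have hp := p.isLt <;> grind [size_succ]
  link := fun _ _ => n = 0

/-- The right conditional expectation tangle `E^k_{k+1}`: the last string of the internal box is
closed, to its right if `k ≠ 0₋` and to its left if `k = 0₋`; the other points are joined to
those of the external box. For `k = 0₋` the black region is an annulus. -/
def rightExp (k : Col) : Tangle where
  Disc := Unit
  ext := k
  int := fun _ => k.up
  circles := 0
  string := fun
    | Sum.inl p =>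
      if p.val < k.size then Sum.inr ⟨(), ⟨p.val, by have := p.isLt; simp only [size_up]; omega⟩⟩
      else Sum.inr ⟨(), ⟨p.val + 2, by have := p.isLt; simp only [size_up]; omega⟩⟩
    | Sum.inr ⟨_, p⟩ =>
      if h : p.val < k.size then Sum.inl ⟨p.val, by omega⟩
      else if h1 : p.val = k.size then
        Sum.inr ⟨(), ⟨k.size + 1, by simp only [size_up]; omega⟩⟩
      else if h2 : p.val = k.size + 1 then
        Sum.inr ⟨(), ⟨k.size, by simp only [size_up]; omega⟩⟩
      else Sum.inl ⟨p.val - 2, by have := p.isLt; simp only [size_up] at this; omega⟩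
  string_string := by
    rintro (p | ⟨⟨⟩, p⟩) <;> have hp := p.isLt <;> grind [Fin.ext_iff, size_up]
  shaded := by
    rintro (p | ⟨⟨⟩, p⟩) <;> have hp := p.isLt <;> grind [size_up]
  link := fun _ _ => k = zeroMinus

/-- The multiplication tangle `M_k`: the first box (`false`) is stacked on top of the second one
(`true`). For `k = 0₋` there is one black region, which touches all three discs. -/
def mult (k : Col) : Tangle where
  Disc := Bool
  ext := k
  int := fun _ => k
  circles := 0
  string := fun
    | Sum.inl p => if p.val < k.size then Sum.inr ⟨false, p⟩ else Sum.inr ⟨true, p⟩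
    | Sum.inr ⟨false, p⟩ => if p.val < k.size then Sum.inl p else Sum.inr ⟨true, p.rev⟩
    | Sum.inr ⟨true, p⟩ => if p.val < k.size then Sum.inr ⟨false, p.rev⟩ else Sum.inl p
  string_string := by
    rintro (p | ⟨_ | _, p⟩) <;> have hp := p.isLt <;> grind [Fin.ext_iff, size_up]
  shaded := by
    rintro (p | ⟨_ | _, p⟩) <;> have hp := p.isLt <;> grind [size_up]
  link := fun _ _ => k = zeroMinus

/-- The inclusion tangle `I_k^{k+1}`: a vertical string is added to the right of the internal box,
and to the left of it if `k = 0₋`. For `k = 0₋` the black region is an annulus. -/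
def incl (k : Col) : Tangle where
  Disc := Unit
  ext := k.up
  int := fun _ => k
  circles := 0
  string := fun
    | Sum.inr ⟨_, p⟩ =>
      if p.val < k.size then Sum.inl ⟨p.val, by have := p.isLt; simp only [size_up]; omega⟩
      else Sum.inl ⟨p.val + 2, by have := p.isLt; simp only [size_up]; omega⟩
    | Sum.inl p =>
      if h : p.val < k.size then Sum.inr ⟨(), ⟨p.val, by omega⟩⟩
      else if h1 : p.val = k.size then Sum.inl ⟨k.size + 1, by simp only [size_up]; omega⟩
      else if h2 : p.val = k.size + 1 then Sum.inl ⟨k.size, by simp only [size_up]; omega⟩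
      else Sum.inr ⟨(), ⟨p.val - 2, by have := p.isLt; simp only [size_up] at this; omega⟩⟩
  string_string := by
    rintro (p | ⟨⟨⟩, p⟩) <;> have hp := p.isLt <;> grind [Fin.ext_iff, size_up]
  shaded := by
    rintro (p | ⟨⟨⟩, p⟩) <;> have hp := p.isLt <;> grind [size_up]
  link := fun _ _ => k = zeroMinus

/-- The class of generating tangles
`{1^{0₊}, 1^{0₋}} ∪ {𝓔^k : k ≥ 2} ∪ {(E')^k_k : k ≥ 1} ∪ {E^k_{k+1}, M_k, I_k^{k+1} : k ∈ Col}`. -/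
def generatingTangles : Set Tangle :=
  {unitPlus, unitMinus} ∪ Set.range jones ∪ Set.range leftExp ∪
    (Set.range rightExp ∪ Set.range mult ∪ Set.range incl)

/-- The tangle that surrounds a box of colour `k` (the disc `none`) with 2-boxes, one at each black
interval (the disc `some j` at the interval `j`): one black side of the disc `some j` faces the
interval `j` of the external disc, the other one faces the interval `j` of the disc `none`. For
`k = 0₊` and `k = 0₋` it is the identity tangle. -/
def surround (k : Col) : Tangle where
  Disc := Option (Fin k.size)
  ext := k
  int := fun i => i.elim k fun _ => succ 1
  circles := 0
  string := fun
    | Sum.inl p => Sum.inr ⟨some ⟨p.val / 2, by have := p.isLt; omega⟩,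
        ⟨p.val % 2, by simp only [Option.elim, size_succ]; omega⟩⟩
    | Sum.inr ⟨none, p⟩ => Sum.inr ⟨some ⟨p.val / 2, by
        have := p.isLt; simp only [Option.elim] at this; omega⟩,
        ⟨3 - p.val % 2, by simp only [Option.elim, size_succ]; omega⟩⟩
    | Sum.inr ⟨some j, p⟩ =>
      if p.val < 2 then Sum.inl ⟨2 * j.val + p.val % 2, by have := j.isLt; omega⟩
      else Sum.inr ⟨none, ⟨2 * j.val + (3 - p.val) % 2, by
        have := j.isLt; simp only [Option.elim]; omega⟩⟩
  string_string := by
    rintro (p | ⟨_ | j, p⟩) <;> have hp := p.isLt <;>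
      grind [Fin.ext_iff, size_succ]
  shaded := by
    rintro (p | ⟨_ | j, p⟩) <;> have hp := p.isLt <;>
      grind [size_succ]
  link := fun _ _ => k = zeroMinus

/-- The tangle underlying the basis vectors of colour `m + 1`. Its internal discs are `m` 2-boxes. The
second black side of the box `j` faces the `j`-th black interval of the external disc, and the
first black sides of all boxes lie, in this order, along one black region, together with the
last black interval of the external disc. -/
def star (m : ℕ) : Tangle where
  Disc := Fin m
  ext := succ m
  int := fun _ => succ 1
  circles := 0
  string := fun
    | Sum.inl p =>
      if h : p.val < 2 * m then
        Sum.inr ⟨⟨p.val / 2, by omega⟩, ⟨2 + p.val % 2, by simp only [size_succ]; omega⟩⟩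
      else if hm : m = 0 then Sum.inl p.rev
      else if p.val = 2 * m then
        Sum.inr ⟨⟨m - 1, by omega⟩, ⟨0, by simp only [size_succ]; omega⟩⟩
      else Sum.inr ⟨⟨0, by omega⟩, ⟨1, by simp only [size_succ]; omega⟩⟩
    | Sum.inr ⟨j, p⟩ =>
      if p.val = 0 then
        if h : j.val + 1 < m then
          Sum.inr ⟨⟨j.val + 1, h⟩, ⟨1, by simp only [size_succ]; omega⟩⟩
        else Sum.inl ⟨2 * m, by simp only [size_succ]; omega⟩
      else if p.val = 1 then
        if j.val = 0 then Sum.inl ⟨2 * m + 1, by simp only [size_succ]; omega⟩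
        else Sum.inr ⟨⟨j.val - 1, by omega⟩, ⟨0, by simp only [size_succ]; omega⟩⟩
      else Sum.inl ⟨2 * j.val + p.val % 2, by have := j.isLt; simp only [size_succ]; omega⟩
  string_string := by
    rintro (p | ⟨j, p⟩) <;> have hp := p.isLt <;> grind [Fin.ext_iff, size_succ]
  shaded := by
    rintro (p | ⟨j, p⟩) <;> have hp := p.isLt <;> grind [size_succ]
  link := fun _ _ => False

end Tangles

section GroupAlgebra

variable {H : Type*} [Group H]

/-- The planar algebra `P(H)` of the group subfactor `R^H ⊂ R`: the `k`-box space consists of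
the functions of the spins on the black sides that are invariant under left translation of all spins
by an element of `H`. -/
def P (H : Type*) [Group H] (k : Col) : Submodule ℂ (Box H k) where
  carrier := {f | ∀ (h : H) (a : Fin k.sides → H), f (fun j => h * a j) = f a}
  add_mem' := fun {f g} hf hg h a => by simp [hf h a, hg h a]
  zero_mem' := fun _ _ => rfl
  smul_mem' := fun c f hf h a => by simp [hf h a]

open Classical in
/-- The 2-box labelled `g`. -/
def gen (g : H) : Box H (Col.succ 1) :=
  fun a => if (a ⟨0, Nat.zero_lt_two⟩)⁻¹ * a ⟨1, Nat.one_lt_two⟩ = g then 1 else 0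

theorem gen_mem (g : H) : gen g ∈ P H (Col.succ 1) := by
  intro h a
  classical exact if_congr (by simp [mul_assoc]) rfl rfl

theorem gen_aut (θ : MulAut H) (g : H) (a : Fin (Col.succ 1).sides → H) :
    gen (θ g) (fun j => θ (a j)) = gen g a := by
  classical exact if_congr (by rw [← map_inv, ← map_mul, EmbeddingLike.apply_eq_iff_eq]) rfl rfl

variable [Fintype H]

theorem Z_mem (T : Tangle) (f : ∀ i, Box H (T.int i)) (hf : ∀ i, f i ∈ P H (T.int i)) :
    Z T f ∈ P H T.ext :=
  fun h a => Z_comp' T (Equiv.mulLeft h) f f (fun i b => hf i h b) a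

/-- The labelled tangles `S(g₁, …, g_m)` of colour `k = m + 1`. For `k = 2` this is the 2-box
labelled `g₁`, and for `k = 1` it is a string. -/
def S : (m : ℕ) → (Fin m → H) → Box H (Col.succ m)
  | 0, g => Z (star 0) (fun i => gen (g i))
  | 1, g => gen (g 0)
  | m + 2, g => Z (star (m + 2)) (fun i => gen (g i))

theorem S_mem : ∀ (m : ℕ) (g : Fin m → H), S m g ∈ P H (Col.succ m)
  | 0, g => Z_mem (star 0) (fun i => gen (g i)) (fun _ => gen_mem _)
  | 1, _ => gen_mem _
  | m + 2, g => Z_mem (star (m + 2)) (fun i => gen (g i)) (fun _ => gen_mem _)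

/-- Replacing all labels by their images under an automorphism amounts to applying the automorphism
to the spins. -/
theorem S_aut (θ : MulAut H) : ∀ (m : ℕ) (g : Fin m → H) (a : Fin (Col.succ m).sides → H),
    S m (fun i => θ (g i)) (fun j => θ (a j)) = S m g a
  | 0, g, a => Z_comp' (star 0) θ.toEquiv _ _ (fun i b => gen_aut θ (g i) b) a
  | 1, g, a => gen_aut θ (g 0) a
  | m + 2, g, a => Z_comp' (star (m + 2)) θ.toEquiv _ _ (fun i b => gen_aut θ (g i) b) a

end GroupAlgebra

section Theta

variable {G Θ : Type*} [Group G] [Group Θ] (φ : Θ →* MulAut G)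

/-- `P^Θ`: the elements of `P(G)` that are invariant under the action of `Θ`. -/
def PTheta (k : Col) : Submodule ℂ (Box G k) where
  carrier := {f | f ∈ P G k ∧ ∀ (θ : Θ) (a : Fin k.sides → G), f (fun j => φ θ (a j)) = f a}
  add_mem' := fun {f g} hf hg =>
    ⟨add_mem hf.1 hg.1, fun θ a => by simp [hf.2 θ a, hg.2 θ a]⟩
  zero_mem' := ⟨zero_mem _, fun _ _ => rfl⟩
  smul_mem' := fun c f hf => ⟨Submodule.smul_mem _ c hf.1, fun θ a => by simp [hf.2 θ a]⟩

/-- The constant function `1`. -/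
def one (k : Col) : PTheta φ k := ⟨fun _ => 1, fun _ _ => rfl, fun _ _ => rfl⟩

instance [Fintype G] [Fintype Θ] : Fintype (G ⋊[φ] Θ) :=
  Fintype.ofEquiv (G × Θ) SemidirectProduct.equivProd.symm

variable [Fintype G] [Fintype Θ]

/-- The action of a tangle on `P^Θ`, which is the restriction of its action on `P(G)`. -/
def ZTheta (T : Tangle) (x : ∀ i, PTheta φ (T.int i)) : PTheta φ T.ext :=
  ⟨Z T (fun i => (x i : Box G (T.int i))), Z_mem T _ (fun i => (x i).2.1), fun θ a =>
    Z_comp' T (φ θ).toEquiv _ _ (fun i b => (x i).2.2 θ b) a⟩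

/-- `Θ S(g) = ∑_θ S(θ(g))`. -/
def thetaS (m : ℕ) (g : Fin m → G) : PTheta φ (Col.succ m) :=
  ⟨∑ θ : Θ, S m (fun i => φ θ (g i)), Submodule.sum_mem _ (fun _ _ => S_mem _ _), fun η a => by
    rw [Finset.sum_apply, Finset.sum_apply]
    refine (Fintype.sum_equiv (Equiv.mulLeft η) _ _ (fun θ => ?_)).symm
    rw [← S_aut (φ η) m (fun i => φ θ (g i)) a]
    simp⟩

/-- The biprojection `q = |Θ|⁻¹ ∑_θ (e, θ)` of `R^{G ⋊ Θ} ⊂ R^Θ ⊂ R`. -/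
def q : Box (G ⋊[φ] Θ) (Col.succ 1) :=
  ((Fintype.card Θ : ℂ)⁻¹) • ∑ θ : Θ, gen (⟨1, θ⟩ : G ⋊[φ] Θ)

/-- The inputs of the tangle `surround k`: `q` at all 2-boxes and `x` at the box of colour `k`. -/
def surroundInput (k : Col) (x : Box (G ⋊[φ] Θ) k) :
    ∀ i : (surround k).Disc, Box (G ⋊[φ] Θ) ((surround k).int i)
  | none => x
  | some _ => q φ

/-- `F_k(x)`: the element `x` surrounded with `q`'s. -/
def F (k : Col) : Box (G ⋊[φ] Θ) k →ₗ[ℂ] Box (G ⋊[φ] Θ) k where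
  toFun x := Z (surround k) (surroundInput φ k x)
  map_add' x y := by
    have h : ∀ z, surroundInput φ k z = Function.update (surroundInput φ k 0) none z := by
      intro z; funext i; cases i <;> rfl
    rw [h (x + y), h x, h y]
    exact (Z (surround k)).map_update_add _ none x y
  map_smul' c x := by
    have h : ∀ z, surroundInput φ k z = Function.update (surroundInput φ k 0) none z := by
      intro z; funext i; cases i <;> rfl
    rw [h (c • x), h x]
    exact (Z (surround k)).map_update_smul _ none c x

/-- `P'_k = F_k(P_k(G ⋊ Θ))`. -/
def PPrime (k : Col) : Submodule ℂ (Box (G ⋊[φ] Θ) k) := (P (G ⋊[φ] Θ) k).map (F φ k)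

theorem PPrime_le (k : Col) : PPrime φ k ≤ P (G ⋊[φ] Θ) k := by
  rintro _ ⟨x, hx, rfl⟩
  refine Z_mem (surround k) _ ?_
  rintro (_ | i)
  · exact hx
  · exact Submodule.smul_mem _ _ (Submodule.sum_mem _ (fun _ _ => gen_mem _))

/-- `α(T) = [R : R^Θ]^{c(T)/2} = |Θ|^{c(T)/2}`. -/
def alpha (Θ : Type*) [Fintype Θ] (T : Tangle) : ℂ :=
  ((Real.sqrt (Fintype.card Θ) : ℝ) : ℂ) ^ T.c

/-- `Z'_T = α(T) Z_{F(T)} = α(T) F_{k₀} ∘ Z_T`, on inputs from `P'`. -/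
def ZPrime (T : Tangle) (x : ∀ i, PPrime φ (T.int i)) : PPrime φ T.ext :=
  ⟨alpha Θ T • F φ T.ext (Z T (fun i => (x i : Box (G ⋊[φ] Θ) (T.int i)))),
    Submodule.smul_mem _ _ (Submodule.mem_map_of_mem
      (Z_mem T _ (fun i => PPrime_le φ _ (x i).2)))⟩

/-- `U(g) = ∑_{θ, γ} S((θ(g₁), γ₁), …, (θ(g_m), γ_m))`. -/
def U (m : ℕ) (g : Fin m → G) : Box (G ⋊[φ] Θ) (Col.succ m) :=
  ∑ θ : Θ, ∑ γ : Fin m → Θ, S m (fun i => (⟨φ θ (g i), γ i⟩ : G ⋊[φ] Θ))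

/-- The defining property of the linear maps `Φ_k : P^Θ_k → P'_k`. For `k = m + 1 ≥ 1`,
`Φ_k(Θ S(g)) = |Θ|^{-⌊k/2⌋} (√|Θ|)^{1 - ⌈k/2⌉} U(g)`. For `k = 0₊, 0₋` both spaces are the scalars
(the constant functions), and `Φ_k` is the identity. -/
def IsPhi (Φ : ∀ k, PTheta φ k →ₗ[ℂ] PPrime φ k) : Prop :=
  (∀ (m : ℕ) (g : Fin m → G),
    (Φ (Col.succ m) (thetaS φ m g) : Box (G ⋊[φ] Θ) (Col.succ m)) =
      ((Fintype.card Θ : ℂ) ^ (-(((m + 1) / 2 : ℕ) : ℤ)) *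
        ((Real.sqrt (Fintype.card Θ) : ℝ) : ℂ) ^ (1 - (((m + 2) / 2 : ℕ) : ℤ))) • U φ m g) ∧
  (Φ Col.zeroPlus (one φ Col.zeroPlus) : Box (G ⋊[φ] Θ) Col.zeroPlus) = (fun _ => 1) ∧
  (Φ Col.zeroMinus (one φ Col.zeroMinus) : Box (G ⋊[φ] Θ) Col.zeroMinus) = (fun _ => 1)

/-- The set of the tangles `T` with
`Φ_{k₀}(Z_T(x₁ ⊗ ⋯ ⊗ x_b)) = Z'_T(Φ_{k₁}(x₁) ⊗ ⋯ ⊗ Φ_{k_b}(x_b))` for all inputs from `P^Θ`. -/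
def intertwined (Φ : ∀ k, PTheta φ k →ₗ[ℂ] PPrime φ k) : Set Tangle :=
  {T | ∀ x : ∀ i, PTheta φ (T.int i),
    Φ T.ext (ZTheta φ T x) = ZPrime φ T (fun i => Φ (T.int i) (x i))}

end Theta

end

end GroupPlanar

namespace GroupPlanar

noncomputable section

open Col

/-! ### Loops, black regions and turning numbers. -/

namespace Tangle

/-! Up to a scalar, `Φ_k` is composition with the projection `G ⋊ Θ → G` of spins (`lift`). Left
translation by `(h, η)` acts on the components in `G` as `x ↦ h η(x)`, so a function that is
invariant under `G` and `Θ` lifts to one invariant under `G ⋊ Θ`. Moreover `q` vanishes unless its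
two spins have the same component in `G`, and its value there is constant; hence `F_k` averages over
the fibres of the projection (`F_eq_average`) and fixes lifts.

In `U(ḡ)` the sum over `γ̄` removes the dependence on the components in `Θ`, so `U(ḡ)` is a multiple
of the lift of `ΘS(ḡ)` (`U_eq`). This gives existence with `Φ_k = |Θ|^(-⌊k/2⌋) • lift`. Uniqueness
holds because the `ΘS(ḡ)` span `P^Θ_k` for `k ≥ 1` (`span_thetaS`), while for `k = 0₊, 0₋` only
constants occur.

Intertwining holds for every `Tangle`. Averaging `Z_T` of lifted inputs over a fibre counts each
state with spins in `G` once for every choice of a component in `Θ` on each black region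
(`sum_fibre_states`). What remains is an identity between powers of `√|Θ|`: by the formula for
`turning`, the numbers of regions and, thanks to `α(T)`, of loops cancel. -/

theorem turning_eq (T : Tangle) :
    T.turning = T.halfColours + 2 * T.ext.isMinus + T.loops - 2 * T.regions := by
  unfold turning eulerBlack
  ring

/-- If no black region has a disconnected boundary, the loops are in bijection with the regions. -/
theorem loops_eq_regions (T : Tangle) (hside : Function.Surjective T.side)
    (hcirc : T.circles = 0) (hlink : ∀ a b, ¬ T.link a b) : T.loops = T.regions := by
  unfold loops regions
  rw [hcirc, add_zero]
  have hwd : ∀ p p' : T.Point, (p' = T.string p ∨ T.side p' = T.side p) →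
      Quot.mk T.sameRegion (T.side p) = Quot.mk T.sameRegion (T.side p') := by
    rintro p p' (rfl | h)
    · exact Quot.sound (Or.inl ⟨p, rfl, rfl⟩)
    · rw [h]
  refine Nat.card_congr (Equiv.ofBijective
    (Quot.lift (fun p => Quot.mk T.sameRegion (T.side p)) hwd) ⟨?_, ?_⟩)
  -- The inverse picks a marked point on each side. Another point of that side lies on the same
  -- loop, and only strings identify sides, as there are no links.
  · let inv : Quot T.sameRegion →
        Quot fun p p' : T.Point => p' = T.string p ∨ T.side p' = T.side p :=
      Quot.lift (fun a => Quot.mk _ (Function.surjInv hside a)) (by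
        rintro _ _ (⟨p, rfl, rfl⟩ | h)
        · calc Quot.mk _ (Function.surjInv hside (T.side p))
              = Quot.mk _ p := Quot.sound (Or.inr (Function.surjInv_eq hside _).symm)
            _ = Quot.mk _ (T.string p) := Quot.sound (Or.inl rfl)
            _ = _ := Quot.sound (Or.inr (Function.surjInv_eq hside _))
        · exact (hlink _ _ h).elim)
    refine Function.LeftInverse.injective (g := inv) ?_
    rintro ⟨p⟩
    exact Quot.sound (Or.inr (Function.surjInv_eq hside _).symm)
  · rintro ⟨a⟩
    obtain ⟨p, rfl⟩ := hside a
    exact ⟨Quot.mk _ p, rfl⟩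

theorem side_inl_eq (T : Tangle) {p : Fin (2 * T.ext.size)} {b : Fin T.ext.sides}
    (h : p.val / 2 = b.val) : T.side (Sum.inl p) = Sum.inl b :=
  congrArg Sum.inl (Fin.ext h)

theorem side_inr_eq (T : Tangle) {i : T.Disc} {p : Fin (2 * (T.int i).size)}
    {b : Fin (T.int i).sides} (h : p.val / 2 = b.val) :
    T.side (Sum.inr ⟨i, p⟩) = Sum.inr (Sum.inl ⟨i, b⟩) := by
  obtain rfl : (T.int i).sideOf p = b := Fin.ext h
  rfl

theorem mk_side (T : Tangle) {p p' : T.Point} {a b : T.Side} (h : T.string p = p')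
    (ha : T.side p = a) (hb : T.side p' = b) :
    Quot.mk T.sameRegion a = Quot.mk T.sameRegion b := by
  subst h ha hb
  exact Quot.sound (Or.inl ⟨p, rfl, rfl⟩)

/-- A labelling of the black regions of a tangle. -/
structure RegionLabelling (T : Tangle) (α : Type) where
  /-- The label of the region of a side. -/
  label : T.Side → α
  /-- A side of the region with a given label. -/
  rep : α → T.Side
  label_rep : ∀ x, label (rep x) = x
  label_eq : ∀ a b, T.sameRegion a b → label a = label b
  mk_rep : ∀ a, Quot.mk T.sameRegion (rep (label a)) = Quot.mk T.sameRegion a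

namespace RegionLabelling

variable {T : Tangle} {α : Type}

theorem regions_eq (L : T.RegionLabelling α) : T.regions = Nat.card α := by
  refine Nat.card_congr ⟨Quot.lift L.label L.label_eq, fun x => Quot.mk _ (L.rep x), ?_, L.label_rep⟩
  rintro ⟨a⟩
  exact L.mk_rep a

/-- This turns sums over states into sums over spins indexed by the labels. -/
theorem eq_comp_label (L : T.RegionLabelling α) {H : Type*} (s : T.Side → H) (hs : ∀ x y, T.sameRegion x y → s x = s y) :
    s = fun a => s (L.rep (L.label a)) := by
  funext a
  exact (congrArg (Quot.lift s hs) (L.mk_rep a)).symm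

end RegionLabelling

end Tangle

/-! ### Black regions of the star and surrounding tangles. -/

theorem Col.sideOf_surjective (n : ℕ) : Function.Surjective (sideOf (succ n)) := fun j =>
  ⟨⟨2 * j.val, by have := j.isLt; simp only [size_succ, sides] at *; omega⟩, by
    ext; simp [sideOf]⟩

/-- The label of the black region of a side of `star m`: the number of the external black interval
that it touches. -/
def starLabel (m : ℕ) : (star m).Side → Fin (m + 1)
  | Sum.inl j => j
  | Sum.inr (Sum.inl ⟨j, b⟩) => if b.val = 0 then Fin.last m else Fin.castSucc j
  | Sum.inr (Sum.inr i) => Fin.elim0 i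

/-- Induction on the number `d` of boxes after `j`: point `0` of a box is joined to point `1` of the
next box, and for the last box to the last external interval. -/
theorem star_mk_first (m : ℕ) (d : ℕ) : ∀ (j : Fin m), j.val + 1 + d = m →
    Quot.mk (star m).sameRegion (Sum.inl (Fin.last m)) =
      Quot.mk (star m).sameRegion (Sum.inr (Sum.inl ⟨j, ⟨0, Nat.zero_lt_two⟩⟩)) := by
  induction d with
  | zero =>
    intro j hj
    have h : ¬ (j.val + 1 < m) := by omega
    symm
    refine (star m).mk_side (p := Sum.inr ⟨j, ⟨0, Nat.succ_pos 3⟩⟩)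
      (p' := Sum.inl ⟨2 * m, by show _ < 2 * (m + 1); omega⟩) ?_ ?_ ?_
    · simp [star, h]
    · exact (star m).side_inr_eq (by simp)
    · exact (star m).side_inl_eq (by show 2 * m / 2 = m; omega)
  | succ d ih =>
    intro j hj
    have h : j.val + 1 < m := by omega
    refine (ih ⟨j.val + 1, h⟩ (by simp only; omega)).trans ?_
    symm
    refine (star m).mk_side (p := Sum.inr ⟨j, ⟨0, Nat.succ_pos 3⟩⟩)
      (p' := Sum.inr ⟨⟨j.val + 1, h⟩, ⟨1, by show 1 < 4; omega⟩⟩) ?_ ?_ ?_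
    · simp [star, h]
    · exact (star m).side_inr_eq (by simp)
    · exact (star m).side_inr_eq (by simp)

theorem star_mk_second (m : ℕ) (j : Fin m) :
    Quot.mk (star m).sameRegion (Sum.inl (Fin.castSucc j)) =
      Quot.mk (star m).sameRegion (Sum.inr (Sum.inl ⟨j, ⟨1, Nat.one_lt_two⟩⟩)) := by
  symm
  refine (star m).mk_side (p := Sum.inr ⟨j, ⟨2, by show 2 < 4; omega⟩⟩)
    (p' := Sum.inl ⟨2 * j.val, by show _ < 2 * (m + 1); omega⟩) ?_ ?_ ?_
  · simp [star]
  · exact (star m).side_inr_eq (by simp)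
  · exact (star m).side_inl_eq (by show 2 * j.val / 2 = j.val; omega)

theorem starLabel_inl_val (m : ℕ) (p : Fin (2 * (star m).ext.size)) :
    (starLabel m ((star m).side (Sum.inl p))).val = p.val / 2 := rfl

theorem starLabel_inr_val (m : ℕ) (j : Fin m) (p : Fin (2 * (succ 1).size)) :
    (starLabel m ((star m).side (Sum.inr ⟨j, p⟩))).val = if p.val / 2 = 0 then m else j.val := by
  have : starLabel m ((star m).side (Sum.inr ⟨j, p⟩)) =
    if p.val / 2 = 0 then Fin.last m else Fin.castSucc j := rfl
  rw [this]
  split_ifs <;> rfl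

theorem starLabel_eq (m : ℕ) (p : (star m).Point) :
    starLabel m ((star m).side p) = starLabel m ((star m).side ((star m).string p)) := by
  apply Fin.ext
  rcases p with p | ⟨j, p⟩
  · have hp : p.val < 2 * (m + 1) := p.isLt
    rw [starLabel_inl_val]
    by_cases h : p.val < 2 * m
    · have hs : (star m).string (Sum.inl p) = Sum.inr ⟨⟨p.val / 2, by omega⟩,
          ⟨2 + p.val % 2, by show _ < 4; omega⟩⟩ := dif_pos h
      rw [hs]
      refine Eq.trans ?_ (starLabel_inr_val m _ _).symm
      rw [if_neg (by simp)]
    · by_cases hm : m = 0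
      · have hs : (star m).string (Sum.inl p) = Sum.inl p.rev := (dif_neg h).trans (dif_pos hm)
        have hr : p.rev.val = 2 * (m + 1) - (p.val + 1) := Fin.val_rev p
        rw [hs, starLabel_inl_val, hr]
        omega
      · by_cases h' : p.val = 2 * m
        · have hs : (star m).string (Sum.inl p) = Sum.inr ⟨⟨m - 1, by omega⟩,
              ⟨0, Nat.succ_pos 3⟩⟩ := (dif_neg h).trans ((dif_neg hm).trans (if_pos h'))
          rw [hs]
          refine Eq.trans ?_ (starLabel_inr_val m _ _).symm
          rw [if_pos (by simp), h']
          omega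
        · have hs : (star m).string (Sum.inl p) = Sum.inr ⟨⟨0, by omega⟩,
              ⟨1, by show 1 < 4; omega⟩⟩ := (dif_neg h).trans ((dif_neg hm).trans (if_neg h'))
          rw [hs]
          refine Eq.trans ?_ (starLabel_inr_val m _ _).symm
          rw [if_pos (by simp)]
          omega
  · have hp : p.val < 4 := p.isLt
    have hj : j.val < m := j.isLt
    refine (starLabel_inr_val m j p).trans ?_
    by_cases h0 : p.val = 0
    · rw [if_pos (by omega)]
      by_cases h : j.val + 1 < m
      · have hs : (star m).string (Sum.inr ⟨j, p⟩) = Sum.inr ⟨⟨j.val + 1, h⟩,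
            ⟨1, by show 1 < 4; omega⟩⟩ := (if_pos h0).trans (dif_pos h)
        rw [hs]
        refine Eq.trans ?_ (starLabel_inr_val m _ _).symm
        rw [if_pos (by simp)]
      · have hs : (star m).string (Sum.inr ⟨j, p⟩) = Sum.inl ⟨2 * m,
            by show _ < 2 * (m + 1); omega⟩ := (if_pos h0).trans (dif_neg h)
        rw [hs]
        refine Eq.trans ?_ (starLabel_inl_val m _).symm
        simp
    · by_cases h1 : p.val = 1
      · rw [if_pos (by omega)]
        by_cases h : j.val = 0
        · have hs : (star m).string (Sum.inr ⟨j, p⟩) = Sum.inl ⟨2 * m + 1,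
              by show _ < 2 * (m + 1); omega⟩ :=
            (if_neg h0).trans ((if_pos h1).trans (if_pos h))
          rw [hs]
          refine Eq.trans ?_ (starLabel_inl_val m _).symm
          simp only
          omega
        · have hs : (star m).string (Sum.inr ⟨j, p⟩) = Sum.inr ⟨⟨j.val - 1, by omega⟩,
              ⟨0, Nat.succ_pos 3⟩⟩ := (if_neg h0).trans ((if_pos h1).trans (if_neg h))
          rw [hs]
          refine Eq.trans ?_ (starLabel_inr_val m _ _).symm
          rw [if_pos (by simp)]
      · have hs : (star m).string (Sum.inr ⟨j, p⟩) = Sum.inl ⟨2 * j.val + p.val % 2,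
            by show _ < 2 * (m + 1); omega⟩ := (if_neg h0).trans (if_neg h1)
        rw [if_neg (by omega), hs]
        refine Eq.trans ?_ (starLabel_inl_val m _).symm
        simp only
        omega

/-- The black regions of `star m` correspond to the external black intervals. -/
def starRegions (m : ℕ) : (star m).RegionLabelling (Fin (m + 1)) where
  label := starLabel m
  rep := Sum.inl
  label_rep _ := rfl
  label_eq := by
    rintro _ _ (⟨p, rfl, rfl⟩ | h)
    · exact starLabel_eq m p
    · exact h.elim
  mk_rep := by
    rintro (j | ⟨j, b⟩ | i)
    · rfl
    · obtain ⟨b, hb⟩ := b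
      have hb : b < 2 := hb
      interval_cases b
      · exact star_mk_first m (m - 1 - j.val) j (by have : j.val < m := j.isLt; omega)
      · exact star_mk_second m j
    · exact Fin.elim0 i

/-- There are `m + 1` loops and as many regions, and each of the `m` 2-boxes adds `1` to `⌈(m +
1)/2⌉` in `halfColours`. -/
theorem star_turning (m : ℕ) : (star m).turning = (((m + 2) / 2 : ℕ) : ℤ) - 1 := by
  have hreg : (star m).regions = m + 1 := by
    rw [(starRegions m).regions_eq, Nat.card_eq_fintype_card, Fintype.card_fin]
  have hloop : (star m).loops = m + 1 := by
    rw [← hreg]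
    refine Tangle.loops_eq_regions _ ?_ rfl (fun _ _ h => h)
    rintro (j | ⟨i, j⟩ | i)
    · obtain ⟨p, rfl⟩ := Col.sideOf_surjective m j
      exact ⟨Sum.inl p, rfl⟩
    · obtain ⟨p, rfl⟩ := Col.sideOf_surjective 1 j
      exact ⟨Sum.inr ⟨i, p⟩, rfl⟩
    · exact Fin.elim0 i
  have hhalf : (star m).halfColours = (((m + 2) / 2 : ℕ) : ℤ) + m := by
    have : (star m).halfColours = (((m + 2) / 2 : ℕ) : ℤ) +
        ∑ _i : Fin m, (((succ 1).size / 2 : ℕ) : ℤ) := rfl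
    rw [this]
    simp [size]
  have hm : (star m).ext.isMinus = 0 := rfl
  rw [Tangle.turning_eq, hreg, hloop, hhalf, hm]
  push_cast
  ring

/-- The label of the black region of a side of the surrounding tangle: the number of the black
interval together with the disc, external (`inl`) or `none` (`inr`), that the region touches. -/
def surroundLabel (n : ℕ) : (surround (succ n)).Side → Fin (n + 1) ⊕ Fin (n + 1)
  | Sum.inl j => Sum.inl j
  | Sum.inr (Sum.inl ⟨none, j⟩) => Sum.inr j
  | Sum.inr (Sum.inl ⟨some j, b⟩) => if b.val = 0 then Sum.inl j else Sum.inr j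
  | Sum.inr (Sum.inr i) => Fin.elim0 i

theorem surroundLabel_eq (n : ℕ) (p : (surround (succ n)).Point) :
    surroundLabel n ((surround (succ n)).side p) =
      surroundLabel n ((surround (succ n)).side ((surround (succ n)).string p)) := by
  rcases p with p | ⟨_ | j, p⟩
  · exact (if_pos (show p.val % 2 / 2 = 0 by omega)).symm
  · exact (if_neg (show (3 - p.val % 2) / 2 ≠ 0 by omega)).symm
  · have hp : p.val < 4 := p.isLt
    simp only [surround]
    split_ifs with h
    · refine (if_pos (show p.val / 2 = 0 by omega)).trans ?_
      exact congrArg Sum.inl (Fin.ext (show j.val = (2 * j.val + p.val % 2) / 2 by omega))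
    · refine (if_neg (show p.val / 2 ≠ 0 by omega)).trans ?_
      exact congrArg Sum.inr (Fin.ext (show j.val = (2 * j.val + (3 - p.val) % 2) / 2 by omega))

/-- The black regions of the surrounding tangle. -/
def surroundRegions (n : ℕ) :
    (surround (succ n)).RegionLabelling (Fin (n + 1) ⊕ Fin (n + 1)) where
  label := surroundLabel n
  rep := Sum.elim Sum.inl fun j => Sum.inr (Sum.inl ⟨none, j⟩)
  label_rep := by rintro (j | j) <;> rfl
  label_eq := by
    rintro _ _ (⟨p, rfl, rfl⟩ | h)
    · exact surroundLabel_eq n p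
    · exact Col.noConfusion h
  mk_rep := by
    rintro (j | ⟨_ | j, b⟩ | i)
    · rfl
    · rfl
    · obtain ⟨b, hb⟩ := b
      have hb : b < 2 := hb
      interval_cases b
      · symm
        refine (surround (succ n)).mk_side (p := Sum.inr ⟨some j, ⟨0, Nat.succ_pos 3⟩⟩)
          (p' := Sum.inl ⟨2 * j.val, ?_⟩) ?_ ?_ ?_
        · have := j.isLt
          show _ < 2 * (n + 1)
          simp only [size_succ] at this
          omega
        · rfl
        · exact (surround (succ n)).side_inr_eq (by simp)
        · exact congrArg Sum.inl (Fin.ext (show 2 * j.val / 2 = j.val by omega))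
      · symm
        refine (surround (succ n)).mk_side
          (p := Sum.inr ⟨some j, ⟨3, by show 3 < 4; omega⟩⟩)
          (p' := Sum.inr ⟨none, ⟨2 * j.val, ?_⟩⟩) ?_ ?_ ?_
        · have := j.isLt
          show _ < 2 * (n + 1)
          simp only [size_succ] at this
          omega
        · rfl
        · exact (surround (succ n)).side_inr_eq (by simp)
        · exact (surround (succ n)).side_inr_eq (show 2 * j.val / 2 = j.val by omega)
    · exact Fin.elim0 i

/-- With `k = n + 1`, loops and regions both number `2k`, and `halfColours` is `⌈k/2⌉ + ⌊k/2⌋ + k =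
2k`. Thus surrounding carries no normalising factor. -/
theorem surround_turning_succ (n : ℕ) : (surround (succ n)).turning = 0 := by
  have hreg : (surround (succ n)).regions = 2 * (n + 1) := by
    rw [(surroundRegions n).regions_eq, Nat.card_eq_fintype_card, Fintype.card_sum,
      Fintype.card_fin]
    ring
  have hloop : (surround (succ n)).loops = 2 * (n + 1) := by
    rw [← hreg]
    refine Tangle.loops_eq_regions _ ?_ rfl (fun _ _ h => Col.noConfusion h)
    rintro (j | ⟨_ | i, j⟩ | i)
    · obtain ⟨p, rfl⟩ := Col.sideOf_surjective n j
      exact ⟨Sum.inl p, rfl⟩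
    · obtain ⟨p, rfl⟩ := Col.sideOf_surjective n j
      exact ⟨Sum.inr ⟨none, p⟩, rfl⟩
    · obtain ⟨p, rfl⟩ := Col.sideOf_surjective 1 j
      exact ⟨Sum.inr ⟨some i, p⟩, rfl⟩
    · exact Fin.elim0 i
  have hhalf : (surround (succ n)).halfColours = 2 * (n + 1) := by
    have : (surround (succ n)).halfColours = (((n + 2) / 2 : ℕ) : ℤ) +
        ∑ i : Option (Fin (n + 1)), (((i.elim (succ n) fun _ => succ 1).size / 2 : ℕ) : ℤ) := rfl
    rw [this, Fintype.sum_option]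
    simp [size]
    omega
  have hm : (surround (succ n)).ext.isMinus = 0 := rfl
  rw [Tangle.turning_eq, hreg, hloop, hhalf, hm]
  push_cast
  ring

/-! ### State sums of the star and surrounding tangles. -/

section Star

variable {H : Type*} [Fintype H]

/-- The exponent of `√|H|` in the values of the basis vectors of colour `m + 1`. -/
def starExp (m : ℕ) : ℤ := (((m + 2) / 2 : ℕ) : ℤ) - 1

/-- Every black region touches the external disc, so the external spins determine the state. -/
theorem states_star (m : ℕ) (a : Fin (m + 1) → H) :
    states (star m) a = {fun x => a (starLabel m x)} := by
  ext s
  simp only [states, Finset.mem_filter, Finset.mem_univ, true_and, Finset.mem_singleton]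
  constructor
  · rintro ⟨hs, ha⟩
    rw [(starRegions m).eq_comp_label s hs]
    funext x
    exact ha _
  · rintro rfl
    exact ⟨fun x y h => congrArg a ((starRegions m).label_eq x y h), fun j => rfl⟩

open Classical in
theorem Z_star [Group H] (m : ℕ) (g : Fin m → H) (a : Fin (m + 1) → H) :
    Z (star m) (fun i => gen (g i)) a = ((Real.sqrt (Fintype.card H) : ℝ) : ℂ) ^ starExp m *
      if ∀ j : Fin m, (a (Fin.last m))⁻¹ * a j.castSucc = g j then 1 else 0 := by
  refine (Z_apply (star m) (fun i => gen (g i)) a).trans ?_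
  rw [star_turning, ← starExp]
  refine congrArg _ ?_
  refine (Finset.sum_congr (states_star m a) fun _ _ => rfl).trans ?_
  refine (Finset.sum_singleton _ _).trans ?_
  exact (Fintype.prod_boole (M₀ := ℂ)
    (p := fun j : Fin m => (a (Fin.last m))⁻¹ * a j.castSucc = g j)).trans
    (by congr)

/-- The black intervals of a disc of colour `m + 1`, with the one whose spin is the reference spin
of the basis vectors as `none`. -/
def baseEquiv (m : ℕ) : Option (Fin m) ≃ Fin (m + 1) :=
  if m = 1 then (finSuccEquiv m).symm else finSuccEquivLast.symm

open Classical in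
theorem S_apply [Group H] : ∀ (m : ℕ) (g : Fin m → H) (a : Fin (m + 1) → H),
    S m g a = ((Real.sqrt (Fintype.card H) : ℝ) : ℂ) ^ starExp m *
      if ∀ j : Fin m, (a (baseEquiv m none))⁻¹ * a (baseEquiv m (some j)) = g j then 1 else 0
  | 0, g, a => Z_star 0 g a
  -- For `k = 2` the vector is the bare 2-box, whose reference spin is at interval `0` instead of
  -- the last one.
  | 1, g, a => by
    have : starExp 1 = 0 := rfl
    rw [this, zpow_zero, one_mul]
    refine if_congr ?_ rfl rfl
    rw [Fin.forall_fin_one]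
    exact Iff.rfl
  | m + 2, g, a => by
    have : baseEquiv (m + 2) = finSuccEquivLast.symm := if_neg (by omega)
    rw [this]
    simp only [finSuccEquivLast_symm_none, finSuccEquivLast_symm_some]
    exact Z_star (m + 2) g a

end Star

section Surround

variable {H : Type*} [Fintype H]

/-- A state of the surrounding tangle is determined by its spins at the external disc and at the
disc `none`. -/
theorem sum_states_surround (n : ℕ) (a : Fin (n + 1) → H)
    (w : ((surround (succ n)).Side → H) → ℂ) :
    ∑ s ∈ states (surround (succ n)) a, w s =
      ∑ b : Fin (n + 1) → H, w (fun x => Sum.elim a b (surroundLabel n x)) := by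
  refine Finset.sum_bij' (fun s _ j => s (Sum.inr (Sum.inl ⟨none, j⟩)))
    (fun b _ x => Sum.elim a b (surroundLabel n x)) ?_ ?_ ?_ ?_ ?_
  · intro s _
    exact Finset.mem_univ _
  · intro b _
    simp only [states, Finset.mem_filter, Finset.mem_univ, true_and]
    exact ⟨fun x y h => congrArg _ ((surroundRegions n).label_eq x y h), fun j => rfl⟩
  · intro s hs
    simp only [states, Finset.mem_filter, Finset.mem_univ, true_and] at hs
    conv_rhs => rw [(surroundRegions n).eq_comp_label s hs.1]
    funext x
    show _ = s ((surroundRegions n).rep (surroundLabel n x))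
    rcases surroundLabel n x with j | j
    · exact (hs.2 j).symm
    · rfl
  · intro b _
    rfl
  · intro s hs
    congr 1
    simp only [states, Finset.mem_filter, Finset.mem_univ, true_and] at hs
    conv_lhs => rw [(surroundRegions n).eq_comp_label s hs.1]
    funext x
    show s ((surroundRegions n).rep (surroundLabel n x)) = _
    rcases surroundLabel n x with j | j
    · exact (hs.2 j)
    · rfl

end Surround

/-! ### Lifting functions from `G` to `G ⋊ Θ`, and averaging over fibres. -/

section Lift

variable {G Θ : Type*} [Group G] [Group Θ] {φ : Θ →* MulAut G}

/-- The components in `Θ` enter only through a twist by an automorphism. The twist does not affect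
whether the result is `1`, and a sum over `Θ` absorbs it. -/
theorem inv_mul_left (x y : G ⋊[φ] Θ) :
    (x⁻¹ * y).left = φ x.right⁻¹ (x.left⁻¹ * y.left) := by
  simp

/-- The function of spins in `G ⋊ Θ` that depends only on the components in `G`. -/
def lift (φ : Θ →* MulAut G) (k : Col) : Box G k →ₗ[ℂ] Box (G ⋊[φ] Θ) k where
  toFun f a := f fun j => (a j).left
  map_add' _ _ := rfl
  map_smul' _ _ := rfl

theorem lift_apply (k : Col) (f : Box G k) (a : Fin k.sides → G ⋊[φ] Θ) :
    lift φ k f a = f fun j => (a j).left := rfl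

/-- Translation by `h` factors on the components in `G` as the automorphism of `h.right` followed by
translation by `h.left`. -/
theorem lift_mem {k : Col} {f : Box G k} (hf : f ∈ PTheta φ k) : lift φ k f ∈ P (G ⋊[φ] Θ) k := by
  intro h a
  exact (hf.1 h.left fun j => φ h.right (a j).left).trans (hf.2 h.right fun j => (a j).left)

theorem gen_mk_apply [DecidableEq G] [DecidableEq Θ] (θ : Θ)
    (a : Fin (succ 1).sides → G ⋊[φ] Θ) : gen (⟨1, θ⟩ : G ⋊[φ] Θ) a =
      if ((a ⟨0, Nat.zero_lt_two⟩)⁻¹ * a ⟨1, Nat.one_lt_two⟩).right = θ then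
        if (a ⟨0, Nat.zero_lt_two⟩).left = (a ⟨1, Nat.one_lt_two⟩).left then 1 else 0
      else 0 := by
  rw [← ite_and, gen]
  congr 1
  refine propext ?_
  rw [SemidirectProduct.ext_iff, inv_mul_left,
    map_eq_one_iff _ (φ (a ⟨0, Nat.zero_lt_two⟩).right⁻¹).injective, inv_mul_eq_one, and_comm]

/-- Exactly one `θ` in the sum matches the component in `Θ` of the quotient of the two spins. -/
theorem q_apply [Fintype Θ] [DecidableEq G] (a : Fin (succ 1).sides → G ⋊[φ] Θ) :
    q φ a = if (a ⟨0, Nat.zero_lt_two⟩).left = (a ⟨1, Nat.one_lt_two⟩).left then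
      (Fintype.card Θ : ℂ)⁻¹ else 0 := by
  classical
  rw [q, Pi.smul_apply, Finset.sum_apply, Finset.sum_congr rfl fun θ _ => gen_mk_apply θ a,
    Finset.sum_ite_eq, if_pos (Finset.mem_univ _), smul_eq_mul, mul_ite, mul_one, mul_zero]

variable [Fintype G] [Fintype Θ]

open Classical in
/-- The spins in `G ⋊ Θ` with given components in `G`. -/
def fibre (φ : Θ →* MulAut G) {ι : Type*} [Fintype ι] (c : ι → G) : Finset (ι → G ⋊[φ] Θ) :=
  Finset.univ.filter fun b => ∀ j, (b j).left = c j

theorem mem_fibre {ι : Type*} [Fintype ι] {c : ι → G} {b : ι → G ⋊[φ] Θ} :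
    b ∈ fibre φ c ↔ ∀ j, (b j).left = c j := by
  simp [fibre]

theorem card_fibre {ι : Type*} [Fintype ι] (c : ι → G) :
    (fibre φ c).card = Fintype.card Θ ^ Fintype.card ι := by
  classical
  rw [← Fintype.card_fun, ← Finset.card_univ]
  refine Finset.card_bij' (fun b _ j => (b j).right) (fun u _ j => ⟨c j, u j⟩) ?_ ?_ ?_ ?_
  · intro b _
    exact Finset.mem_univ _
  · intro u _
    exact mem_fibre.2 fun _ => rfl
  · intro b hb
    funext j
    exact SemidirectProduct.ext (mem_fibre.1 hb j).symm rfl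
  · intro u _
    rfl

/-- The product is nonzero only if `a` and `b` have equal components in `G` everywhere. -/
theorem sum_fibre_eq [DecidableEq G] {ι : Type*} [Fintype ι] [DecidableEq ι]
    (a : ι → G ⋊[φ] Θ) (y : (ι → G ⋊[φ] Θ) → ℂ) :
    ∑ b, y b * ∏ j, (if (a j).left = (b j).left then (Fintype.card Θ : ℂ)⁻¹ else 0) =
      ((Fintype.card Θ : ℂ) ^ Fintype.card ι)⁻¹ * ∑ b ∈ fibre φ fun j => (a j).left, y b := by
  rw [fibre, Finset.sum_filter, Finset.mul_sum]
  refine Finset.sum_congr (by ext; simp) fun b _ => ?_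
  split_ifs with h
  · simp [h, mul_comm]
  · push Not at h
    obtain ⟨j, hj⟩ := h
    rw [Finset.prod_eq_zero (Finset.mem_univ j) (if_neg (Ne.symm hj)), mul_zero, mul_zero]

/-- Surrounding with `q` averages over the fibres of the projection of the spins to `G`. -/
theorem F_succ (n : ℕ) (x : Box (G ⋊[φ] Θ) (succ n)) (a : Fin (n + 1) → G ⋊[φ] Θ) :
    F φ (succ n) x a = ((Fintype.card Θ : ℂ) ^ (n + 1))⁻¹ *
      ∑ b ∈ fibre φ fun j => (a j).left, x b := by
  classical
  refine (Z_apply (surround (succ n)) (surroundInput φ (succ n) x) a).trans ?_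
  rw [surround_turning_succ, zpow_zero, one_mul]
  refine (sum_states_surround n a _).trans ?_
  have h := sum_fibre_eq (ι := Fin (n + 1)) a x
  rw [Fintype.card_fin] at h
  refine Eq.trans (Fintype.sum_congr _ _ fun b => ?_) h
  refine (Fintype.prod_option (α := Fin (n + 1)) _).trans ?_
  exact congrArg (x b * ·) (Finset.prod_congr rfl fun j _ => q_apply _)

end Lift

/-! ### Surrounding in the colours `0₊` and `0₋`. -/

section ZeroColours

theorem surround_turning_zeroPlus : (surround zeroPlus).turning = 0 := by
  have : IsEmpty (surround zeroPlus).Side := by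
    refine ⟨?_⟩
    rintro (j | ⟨_ | j, b⟩ | i)
    · exact Fin.elim0 j
    · exact Fin.elim0 b
    · exact Fin.elim0 j
    · exact Fin.elim0 i
  have : IsEmpty (surround zeroPlus).Point := ⟨fun p => isEmptyElim ((surround zeroPlus).side p)⟩
  have hreg : (surround zeroPlus).regions = 0 := by
    simp [Tangle.regions]
  have hloop : (surround zeroPlus).loops = 0 := by
    have h : (surround zeroPlus).circles = 0 := rfl
    simp [Tangle.loops, h]
  have hhalf : (surround zeroPlus).halfColours = 0 := rfl
  have hm : (surround zeroPlus).ext.isMinus = 0 := rfl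
  rw [Tangle.turning_eq, hreg, hloop, hhalf, hm]
  rfl

/-- The surrounding tangle of colour `0₋` has one black region. -/
def surroundRegionsMinus : (surround zeroMinus).RegionLabelling Unit where
  label _ := ()
  rep _ := Sum.inl ⟨0, Nat.one_pos⟩
  label_rep _ := rfl
  label_eq _ _ _ := rfl
  mk_rep _ := Quot.sound (Or.inr rfl)

/-- There are no marked points, hence no loops; the term `2 * isMinus` cancels the contribution of
the single region. -/
theorem surround_turning_zeroMinus : (surround zeroMinus).turning = 0 := by
  have : IsEmpty (surround zeroMinus).Point := by
    refine ⟨?_⟩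
    rintro (p | ⟨_ | j, p⟩)
    · exact Fin.elim0 p
    · exact Fin.elim0 p
    · exact Fin.elim0 j
  have hreg : (surround zeroMinus).regions = 1 := by
    rw [surroundRegionsMinus.regions_eq, Nat.card_unique]
  have hloop : (surround zeroMinus).loops = 0 := by
    have h : (surround zeroMinus).circles = 0 := rfl
    simp [Tangle.loops, h]
  have hhalf : (surround zeroMinus).halfColours = 0 := rfl
  have hm : (surround zeroMinus).ext.isMinus = 1 := rfl
  rw [Tangle.turning_eq, hreg, hloop, hhalf, hm]
  rfl

variable {G Θ : Type*} [Group G] [Group Θ] {φ : Θ →* MulAut G} [Fintype G] [Fintype Θ]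

theorem F_zeroPlus (x : Box (G ⋊[φ] Θ) zeroPlus) : F φ zeroPlus x = x := by
  funext a
  refine (Z_apply (surround zeroPlus) (surroundInput φ zeroPlus x) a).trans ?_
  rw [surround_turning_zeroPlus, zpow_zero, one_mul]
  have hside : ∀ y : (surround zeroPlus).Side, False := by
    rintro (j | ⟨_ | j, b⟩ | i)
    · exact Fin.elim0 j
    · exact Fin.elim0 b
    · exact Fin.elim0 j
    · exact Fin.elim0 i
  have hstates : states (surround zeroPlus) a = {fun y => (hside y).elim} := by
    ext s
    simp only [states, Finset.mem_filter, Finset.mem_univ, true_and, Finset.mem_singleton]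
    exact ⟨fun _ => funext fun y => (hside y).elim,
      fun _ => ⟨fun y => (hside y).elim, fun j => Fin.elim0 j⟩⟩
  rw [hstates, Finset.sum_singleton]
  refine (Fintype.prod_option (α := Fin 0) _).trans ?_
  rw [Fin.prod_univ_zero, mul_one]
  exact congrArg x (funext fun j => Fin.elim0 j)

theorem F_zeroMinus (x : Box (G ⋊[φ] Θ) zeroMinus) : F φ zeroMinus x = x := by
  funext a
  refine (Z_apply (surround zeroMinus) (surroundInput φ zeroMinus x) a).trans ?_
  rw [surround_turning_zeroMinus, zpow_zero, one_mul]
  have hstates : states (surround zeroMinus) a = {fun _ => a ⟨0, Nat.one_pos⟩} := by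
    ext s
    simp only [states, Finset.mem_filter, Finset.mem_univ, true_and, Finset.mem_singleton]
    constructor
    · rintro ⟨hs, ha⟩
      exact funext fun y => (hs _ _ (Or.inr rfl)).trans (ha ⟨0, Nat.one_pos⟩)
    · rintro rfl
      exact ⟨fun _ _ _ => rfl, fun j => congrArg a (Subsingleton.elim (α := Fin 1) _ _)⟩
  rw [hstates, Finset.sum_singleton]
  refine (Fintype.prod_option (α := Fin 0) _).trans ?_
  rw [Fin.prod_univ_zero, mul_one]
  exact congrArg x (funext fun j => congrArg a (Subsingleton.elim (α := Fin 1) _ _))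

end ZeroColours

/-! ### Averages over fibres and lifts of states. -/

section Average

variable {G Θ : Type*} [Group G] [Group Θ] {φ : Θ →* MulAut G}

theorem P_zeroMinus_const {H : Type*} [Group H] {x : Box H zeroMinus} (hx : x ∈ P H zeroMinus)
    (a b : Fin zeroMinus.sides → H) : x a = x b := by
  rw [← hx (b ⟨0, Nat.one_pos⟩ * (a ⟨0, Nat.one_pos⟩)⁻¹) a]
  refine congrArg x (funext fun j => ?_)
  obtain rfl : j = ⟨0, Nat.one_pos⟩ := Subsingleton.elim (α := Fin 1) _ _
  simp

variable [Fintype G] [Fintype Θ]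

theorem card_theta_ne_zero (Θ : Type*) [Group Θ] [Fintype Θ] : (Fintype.card Θ : ℂ) ≠ 0 :=
  Nat.cast_ne_zero.2 Fintype.card_ne_zero

theorem average_eq_of_const {n : ℕ} {c : Fin n → G} {y : (Fin n → G ⋊[φ] Θ) → ℂ} {z : ℂ}
    (h : ∀ b ∈ fibre φ c, y b = z) :
    ((Fintype.card Θ : ℂ) ^ n)⁻¹ * ∑ b ∈ fibre φ c, y b = z := by
  rw [Finset.sum_congr rfl h, Finset.sum_const, card_fibre, Fintype.card_fin, nsmul_eq_mul, Nat.cast_pow,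
    inv_mul_cancel_left₀ (pow_ne_zero _ (card_theta_ne_zero Θ))]

/-- This puts all colours under one formula. Invariance of `x` is needed for `0₋`, where `F` is the
identity: the one spin can be translated to any other, so `x` is constant. -/
theorem F_eq_average {k : Col} {x : Box (G ⋊[φ] Θ) k} (hx : x ∈ P (G ⋊[φ] Θ) k)
    (a : Fin k.sides → G ⋊[φ] Θ) :
    F φ k x a = ((Fintype.card Θ : ℂ) ^ k.sides)⁻¹ * ∑ b ∈ fibre φ fun j => (a j).left, x b := by
  cases k with
  | zeroPlus =>
    rw [F_zeroPlus]
    exact (average_eq_of_const fun b _ => congrArg x (funext fun j => Fin.elim0 j)).symm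
  | zeroMinus =>
    rw [F_zeroMinus]
    exact (average_eq_of_const fun b _ => P_zeroMinus_const hx b a).symm
  | succ n => exact F_succ n x a

theorem F_lift {k : Col} {f : Box G k} (hf : f ∈ PTheta φ k) :
    F φ k (lift φ k f) = lift φ k f := by
  funext a
  rw [F_eq_average (lift_mem hf)]
  exact average_eq_of_const fun b hb => congrArg f (funext (mem_fibre.1 hb))

theorem lift_mem_PPrime {k : Col} {f : Box G k} (hf : f ∈ PTheta φ k) :
    lift φ k f ∈ PPrime φ k :=
  ⟨lift φ k f, lift_mem hf, F_lift hf⟩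

theorem sqrt_card_semidirect :
    ((Real.sqrt (Fintype.card (G ⋊[φ] Θ)) : ℝ) : ℂ) =
      ((Real.sqrt (Fintype.card G) : ℝ) : ℂ) * ((Real.sqrt (Fintype.card Θ) : ℝ) : ℂ) := by
  rw [Fintype.card_congr SemidirectProduct.equivProd, Fintype.card_prod, Nat.cast_mul,
    Real.sqrt_mul (Nat.cast_nonneg _), Complex.ofReal_mul]

theorem sqrt_card_sq (Θ : Type*) [Fintype Θ] :
    ((Real.sqrt (Fintype.card Θ) : ℝ) : ℂ) ^ 2 = (Fintype.card Θ : ℂ) := by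
  rw [← Complex.ofReal_pow, Real.sq_sqrt (Nat.cast_nonneg _), Complex.ofReal_natCast]

theorem sqrt_card_ne_zero (Θ : Type*) [Group Θ] [Fintype Θ] :
    ((Real.sqrt (Fintype.card Θ) : ℝ) : ℂ) ≠ 0 := by
  intro h
  have := sqrt_card_sq Θ
  rw [h] at this
  exact card_theta_ne_zero Θ (by simpa using this.symm)

/-- Every state with spins in `G` has `|Θ|` lifts for each black region. -/
theorem sum_fibre_states (T : Tangle) (c : Fin T.ext.sides → G) (w : (T.Side → G) → ℂ) :
    ∑ b ∈ fibre φ c, ∑ s ∈ states T b, w (fun x => (s x).left) =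
      (Fintype.card Θ : ℂ) ^ T.regions * ∑ t ∈ states T c, w t := by
  classical
  have : Fintype (Quot T.sameRegion) := Fintype.ofFinite _
  have hcard : (Fintype.card Θ : ℂ) ^ T.regions =
      ∑ _u : Quot T.sameRegion → Θ, (1 : ℂ) := by
    rw [Finset.sum_const, Finset.card_univ, Fintype.card_fun, Tangle.regions,
      Nat.card_eq_fintype_card, nsmul_eq_mul, mul_one, Nat.cast_pow]
  rw [hcard, Finset.sum_mul_sum, Finset.sum_comm, ← Finset.sum_product', Finset.sum_sigma']
  -- A lifted state corresponds to its components in `G` together with one element of `Θ` per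
  -- region, read off at the representative side `r.out`; the external spins are recovered by
  -- restriction.
  refine Finset.sum_bij'
    (fun (p : Σ _ : Fin T.ext.sides → G ⋊[φ] Θ, T.Side → G ⋊[φ] Θ) _ =>
      (⟨fun x => (p.2 x).left, fun r => (p.2 r.out).right⟩ : (T.Side → G) × (Quot T.sameRegion → Θ)))
    (fun p _ => ⟨fun j => ⟨c j, p.2 (Quot.mk _ (Sum.inl j))⟩,
      fun x => ⟨p.1 x, p.2 (Quot.mk _ x)⟩⟩) ?_ ?_ ?_ ?_ ?_
  · rintro ⟨b, s⟩ h
    simp only [Finset.mem_sigma, mem_fibre, states, Finset.mem_filter, Finset.mem_univ,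
      true_and] at h
    simp only [Finset.mem_product, states, Finset.mem_filter, Finset.mem_univ, true_and, and_true]
    exact ⟨fun x y hxy => by rw [h.2.1 x y hxy], fun j => by rw [h.2.2 j, h.1 j]⟩
  · rintro ⟨t, u⟩ h
    simp only [Finset.mem_product, states, Finset.mem_filter, Finset.mem_univ, true_and,
      and_true] at h
    simp only [Finset.mem_sigma, mem_fibre, states, Finset.mem_filter, Finset.mem_univ,
      true_and]
    exact ⟨fun _ => trivial, fun x y hxy => by rw [h.1 x y hxy, Quot.sound hxy],
      fun j => by rw [h.2 j]⟩
  · rintro ⟨b, s⟩ h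
    simp only [Finset.mem_sigma, mem_fibre, states, Finset.mem_filter, Finset.mem_univ,
      true_and] at h
    have hout : ∀ x, s (Quot.mk T.sameRegion x).out = s x := fun x =>
      congrArg (Quot.lift s h.2.1) (Quot.out_eq (Quot.mk T.sameRegion x))
    have hs : (fun x => (⟨(s x).left, (s (Quot.mk T.sameRegion x).out).right⟩ : G ⋊[φ] Θ)) = s := by
      funext x
      rw [hout]
    have hb : (fun j => (⟨c j, (s (Quot.mk T.sameRegion (Sum.inl j)).out).right⟩ :
        G ⋊[φ] Θ)) = b := by
      funext j
      rw [hout, h.2.2 j, ← h.1 j]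
    simp only [hs, hb]
  · rintro ⟨t, u⟩ _
    simp
  · rintro ⟨b, s⟩ _
    simp

/-- The normalisation `√|G ⋊ Θ| = √|G| √|Θ|` contributes the exponent `turning`, and the lifts of
states contribute `2 * regions`. -/
theorem sum_fibre_Z (T : Tangle) (x : ∀ i, Box G (T.int i)) (c : Fin T.ext.sides → G) :
    ∑ b ∈ fibre φ c, Z T (fun i => lift φ _ (x i)) b =
      ((Real.sqrt (Fintype.card Θ) : ℝ) : ℂ) ^ (T.turning + 2 * T.regions) * Z T x c := by
  simp only [Z_apply, lift_apply]
  rw [← Finset.mul_sum, sum_fibre_states T c fun t => ∏ i, x i fun j => t (Sum.inr (Sum.inl ⟨i, j⟩)),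
    sqrt_card_semidirect, mul_zpow, zpow_add₀ (sqrt_card_ne_zero Θ), zpow_mul, zpow_natCast,
    zpow_ofNat, sqrt_card_sq]
  ring

end Average

/-! ### The maps `Φ_k`: existence, uniqueness and intertwining. -/

section Phi

variable {G Θ : Type*} [Group G] [Group Θ] {φ : Θ →* MulAut G}

theorem eq_smul_one_of_const {k : Col} (f : PTheta φ k)
    (h : ∀ a b, (f : Box G k) a = (f : Box G k) b) :
    f = (f : Box G k) (fun _ => 1) • one φ k := by
  apply Subtype.ext
  funext a
  rw [Submodule.coe_smul, Pi.smul_apply, smul_eq_mul, h a fun _ => 1]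
  exact (mul_one _).symm

variable [Fintype G] [Fintype Θ]

open Classical in
theorem thetaS_apply (m : ℕ) (g : Fin m → G) (a : Fin (m + 1) → G) :
    (thetaS φ m g : Box G (succ m)) a = ((Real.sqrt (Fintype.card G) : ℝ) : ℂ) ^ starExp m *
      ∑ θ : Θ, if ∀ j : Fin m, (a (baseEquiv m none))⁻¹ * a (baseEquiv m (some j)) = φ θ (g j)
        then 1 else 0 := by
  refine (Finset.sum_apply _ _ _).trans ?_
  rw [Finset.mul_sum]
  exact Finset.sum_congr rfl fun θ _ => S_apply m _ a

open Classical in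
-- For each `θ` exactly one `γ` matches the components in `Θ`, so only a condition on the components
-- in `G` survives.
theorem U_apply (m : ℕ) (g : Fin m → G) (a : Fin (m + 1) → G ⋊[φ] Θ) :
    U φ m g a = ((Real.sqrt (Fintype.card (G ⋊[φ] Θ)) : ℝ) : ℂ) ^ starExp m *
      ∑ θ : Θ, if ∀ j : Fin m, ((a (baseEquiv m none)).left)⁻¹ *
        (a (baseEquiv m (some j))).left = φ θ (g j) then 1 else 0 := by
  set r := (a (baseEquiv m none)).right with hr
  refine (Finset.sum_apply _ _ _).trans ?_
  rw [Finset.mul_sum]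
  -- The substitution `θ ↦ r θ` undoes the twist by `r⁻¹`, where `r` is the component in `Θ` of the
  -- reference spin.
  refine Fintype.sum_equiv (Equiv.mulLeft r) _ _ fun θ => ?_
  refine (Finset.sum_apply _ _ _).trans ?_
  refine (Finset.sum_congr rfl fun γ _ => S_apply m _ a).trans ?_
  rw [← Finset.mul_sum]
  refine congrArg _ ?_
  have h : ∀ γ : Fin m → Θ,
      (∀ j, (a (baseEquiv m none))⁻¹ * a (baseEquiv m (some j)) =
        (⟨φ θ (g j), γ j⟩ : G ⋊[φ] Θ)) ↔
      (fun j => ((a (baseEquiv m none))⁻¹ * a (baseEquiv m (some j))).right) = γ ∧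
        ∀ j, ((a (baseEquiv m none)).left)⁻¹ * (a (baseEquiv m (some j))).left =
          φ (r * θ) (g j) := by
    intro γ
    rw [funext_iff, ← forall_and]
    refine forall_congr' fun j => ?_
    rw [SemidirectProduct.ext_iff, inv_mul_left, and_comm, ← hr, map_inv, map_mul φ,
      MulAut.mul_apply, MulAut.inv_apply, MulEquiv.symm_apply_eq]
  simp only [h, ite_and]
  rw [Finset.sum_ite_eq, if_pos (Finset.mem_univ _)]
  rfl

theorem U_eq (m : ℕ) (g : Fin m → G) :
    U φ m g = ((Real.sqrt (Fintype.card Θ) : ℝ) : ℂ) ^ starExp m •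
      lift φ (succ m) (thetaS φ m g) := by
  funext a
  rw [Pi.smul_apply, lift_apply]
  refine (U_apply m g a).trans ?_
  refine Eq.trans ?_ (congrArg _ (thetaS_apply m g fun j => (a j).left).symm)
  rw [sqrt_card_semidirect, mul_zpow, smul_eq_mul]
  ring

/-- The scalar that relates `Φ_k` to the lift of functions. -/
def phiScalar (Θ : Type*) [Fintype Θ] (k : Col) : ℂ :=
  (Fintype.card Θ : ℂ) ^ (-((k.size / 2 : ℕ) : ℤ))

/-- The maps `Φ_k`: up to a scalar, composition with the projection of the spins to `G`. -/
def phi (φ : Θ →* MulAut G) (k : Col) : PTheta φ k →ₗ[ℂ] PPrime φ k :=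
  phiScalar Θ k • (lift φ k).restrict fun _ hf => lift_mem_PPrime hf

theorem phi_apply (k : Col) (f : PTheta φ k) :
    (phi φ k f : Box (G ⋊[φ] Θ) k) = phiScalar Θ k • lift φ k f := rfl

/-- The factor `√|Θ|^(1 - ⌈k/2⌉)` in the prescribed value cancels the power of `√|Θ|` in `U_eq`. -/
theorem isPhi_phi : IsPhi φ (phi φ) := by
  refine ⟨fun m g => ?_, ?_, ?_⟩
  · rw [phi_apply, U_eq, smul_smul, mul_assoc, ← zpow_add₀ (sqrt_card_ne_zero Θ), starExp,
      sub_add_sub_cancel', sub_self, zpow_zero, mul_one]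
    rfl
  · funext a
    simp [phi_apply, phiScalar, size, lift_apply, one]
  · funext a
    simp [phi_apply, phiScalar, size, lift_apply, one]

/-- The invariant functions are linear combinations of the vectors `Θ S(g)`. -/
theorem span_thetaS (m : ℕ) : Submodule.span ℂ (Set.range (thetaS φ m)) = ⊤ := by
  classical
  rw [eq_top_iff]
  rintro ⟨f, hf⟩ -
  -- Invariance under `G` allows the reference spin to be normalised to `1`; the other spins then
  -- become the labels.
  let ins : (Fin m → G) → Fin (m + 1) → G := fun g j => ((baseEquiv m).symm j).elim 1 g
  have hf' : ∀ a : Fin (m + 1) → G, f a =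
      f (ins fun j => (a (baseEquiv m none))⁻¹ * a (baseEquiv m (some j))) := by
    intro a
    refine (hf.1 (a (baseEquiv m none))⁻¹ a).symm.trans (congrArg f (funext fun j => ?_))
    obtain ⟨o, rfl⟩ := (baseEquiv m).surjective j
    cases o <;> simp [ins]
  have hins : ∀ (θ : Θ) (g : Fin m → G), f (ins fun j => φ θ (g j)) = f (ins g) := by
    intro θ g
    refine Eq.trans (congrArg f (funext fun j => ?_)) (hf.2 θ (ins g))
    obtain ⟨o, rfl⟩ := (baseEquiv m).surjective j
    cases o <;> simp [ins]
  -- At a given `a`, each `θ` selects exactly one `g`, and invariance under `Θ` makes its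
  -- contribution `f a` up to normalisation. So `f a` occurs `|Θ|` times, whence the factor `|Θ|⁻¹`.
  have key : (⟨f, hf⟩ : PTheta φ (succ m)) = ∑ g : Fin m → G,
      ((Fintype.card Θ : ℂ)⁻¹ * (((Real.sqrt (Fintype.card G) : ℝ) : ℂ) ^ starExp m)⁻¹ *
        f (ins g)) • thetaS φ m g := by
    apply Subtype.ext
    rw [Submodule.coe_sum]
    funext a
    rw [Finset.sum_apply]
    simp only [Submodule.coe_smul, Pi.smul_apply, smul_eq_mul]
    set d : Fin m → G := fun j => (a (baseEquiv m none))⁻¹ * a (baseEquiv m (some j)) with hd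
    have hterm : ∀ g : Fin m → G,
        (Fintype.card Θ : ℂ)⁻¹ * (((Real.sqrt (Fintype.card G) : ℝ) : ℂ) ^ starExp m)⁻¹ *
          f (ins g) * (thetaS φ m g : Box G (succ m)) a =
        (Fintype.card Θ : ℂ)⁻¹ * ∑ θ : Θ, if (fun j => φ θ⁻¹ (d j)) = g then f a else 0 := by
      intro g
      have h0 : ((Real.sqrt (Fintype.card G) : ℝ) : ℂ) ^ starExp m ≠ 0 :=
        zpow_ne_zero _ (sqrt_card_ne_zero G)
      refine (congrArg _ (thetaS_apply m g a)).trans ?_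
      have hθ : ∀ θ : Θ, f (ins g) * (if ∀ j : Fin m, d j = φ θ (g j) then 1 else 0) =
          if (fun j => φ θ⁻¹ (d j)) = g then f a else 0 := by
        intro θ
        rw [mul_ite, mul_one, mul_zero]
        have hiff : (∀ j : Fin m, d j = φ θ (g j)) ↔ (fun j => φ θ⁻¹ (d j)) = g := by
          rw [funext_iff]
          refine forall_congr' fun j => ?_
          rw [map_inv, MulAut.inv_apply, MulEquiv.symm_apply_eq]
        by_cases h : ∀ j : Fin m, d j = φ θ (g j)
        · rw [if_pos h, if_pos (hiff.1 h), ← hins θ g, ← funext h]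
          exact (hf' a).symm
        · rw [if_neg h, if_neg (mt hiff.2 h)]
      rw [← Finset.sum_congr rfl fun θ _ => hθ θ, ← Finset.mul_sum]
      field_simp
      rfl
    refine Eq.symm ((Finset.sum_congr rfl fun g _ => hterm g).trans ?_)
    rw [← Finset.mul_sum, Finset.sum_comm]
    simp only [Finset.sum_ite_eq, Finset.mem_univ, if_true, Finset.sum_const, Finset.card_univ,
      nsmul_eq_mul]
    rw [inv_mul_cancel_left₀ (card_theta_ne_zero Θ)]
  rw [key]
  exact Submodule.sum_mem _ fun g _ => Submodule.smul_mem _ _ (Submodule.subset_span ⟨g, rfl⟩)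

theorem eq_of_isPhi {Φ Ψ : ∀ k, PTheta φ k →ₗ[ℂ] PPrime φ k} (hΦ : IsPhi φ Φ) (hΨ : IsPhi φ Ψ) :
    Φ = Ψ := by
  funext k
  cases k with
  | zeroPlus =>
    ext1 f
    rw [eq_smul_one_of_const f fun a b => congrArg _ (funext fun j => Fin.elim0 j), map_smul,
      map_smul, Subtype.ext (hΦ.2.1.trans hΨ.2.1.symm)]
  | zeroMinus =>
    ext1 f
    rw [eq_smul_one_of_const f (P_zeroMinus_const f.2.1), map_smul,
      map_smul, Subtype.ext (hΦ.2.2.trans hΨ.2.2.symm)]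
  | succ m =>
    refine LinearMap.ext_on (span_thetaS m) ?_
    rintro _ ⟨g, rfl⟩
    exact Subtype.ext ((hΦ.1 m g).trans (hΨ.1 m g).symm)

theorem Col.sides_eq (k : Col) : k.sides = (k.size + 1) / 2 + k.size / 2 + k.isMinus := by
  cases k <;> simp only [sides, size, isMinus]
  omega

/-- Every tangle is intertwined by the maps `Φ_k`. -/
theorem mem_intertwined_phi (T : Tangle) : T ∈ intertwined φ (phi φ) := by
  intro x
  apply Subtype.ext
  have hP : ∀ i, lift φ (T.int i) (x i) ∈ P (G ⋊[φ] Θ) (T.int i) := fun i => lift_mem (x i).2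
  have hZ : Z T (fun i => (phi φ (T.int i) (x i) : Box (G ⋊[φ] Θ) (T.int i))) =
      (∏ i, phiScalar Θ (T.int i)) • Z T (fun i => lift φ (T.int i) (x i)) := by
    simp only [phi_apply]
    exact (Z T).map_smul_univ _ _
  show phiScalar Θ T.ext • lift φ T.ext (Z T fun i => (x i : Box G (T.int i))) =
    alpha Θ T • F φ T.ext (Z T (fun i => (phi φ (T.int i) (x i) : Box (G ⋊[φ] Θ) (T.int i))))
  rw [hZ, map_smul, smul_smul]
  funext a
  rw [Pi.smul_apply, Pi.smul_apply, F_eq_average (Z_mem T _ hP), sum_fibre_Z, lift_apply,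
    smul_eq_mul, smul_eq_mul, ← mul_assoc, ← mul_assoc]
  -- Both sides are now scalar multiples of `Z T x` at the components of `a` in `G`; only the
  -- scalars have to be compared.
  congr 1
  have h0 := sqrt_card_ne_zero Θ
  have hsq : ∀ z : ℤ, (Fintype.card Θ : ℂ) ^ z =
      ((Real.sqrt (Fintype.card Θ) : ℝ) : ℂ) ^ (2 * z) := fun z => by
    rw [zpow_mul, zpow_ofNat, sqrt_card_sq]
  have hprod : ∏ i, phiScalar Θ (T.int i) =
      ((Real.sqrt (Fintype.card Θ) : ℝ) : ℂ) ^ (-(2 * ∑ i, (((T.int i).size / 2 : ℕ) : ℤ))) := by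
    simp only [phiScalar, zpow_neg, zpow_natCast, Finset.prod_inv_distrib,
      Finset.prod_pow_eq_pow_sum]
    rw [← zpow_natCast, hsq, Nat.cast_sum]
  rw [hprod, phiScalar, alpha, ← zpow_natCast, ← zpow_neg, hsq, hsq, ← zpow_add₀ h0,
    ← zpow_add₀ h0, ← zpow_add₀ h0]
  congr 1
  -- The exponent of `√|Θ|` on the right is `c(T) - 2 ∑ ⌊kᵢ/2⌋ - 2 * sides + turning + 2 * regions`.
  -- Regions and loops cancel, and splitting `sides` leaves `-2 ⌊k₀/2⌋`.
  rw [Tangle.turning_eq, Tangle.c, Col.sides_eq, Tangle.halfColours]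
  push_cast
  ring

end Phi

end

end GroupPlanar

theorem theorem4p9 {G Θ : Type*} [Group G] [Fintype G] [Group Θ] [Fintype Θ]
    (φ : Θ →* MulAut G) :
    (∃! Φ : ∀ k, GroupPlanar.PTheta φ k →ₗ[ℂ] GroupPlanar.PPrime φ k, GroupPlanar.IsPhi φ Φ) ∧
    ∀ Φ : ∀ k, GroupPlanar.PTheta φ k →ₗ[ℂ] GroupPlanar.PPrime φ k, GroupPlanar.IsPhi φ Φ →
      GroupPlanar.generatingTangles ⊆ GroupPlanar.intertwined φ Φ := by
  refine ⟨⟨GroupPlanar.phi φ, GroupPlanar.isPhi_phi, fun Φ hΦ =>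
    GroupPlanar.eq_of_isPhi hΦ GroupPlanar.isPhi_phi⟩, fun Φ hΦ T _ => ?_⟩
  rw [GroupPlanar.eq_of_isPhi hΦ GroupPlanar.isPhi_phi]
  exact GroupPlanar.mem_intertwined_phi T
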